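/- Let $n \in \mathbb N$, $A \in \mathbb R^{n\times n}$, $b \in \mathbb R^n$, $\sigma > 0$, and let $f : \mathbb R^n \times \mathbb R \to \mathbb R^n$ be real-analytic with $f(y) = O(|y|^2)$ as $y \to 0$. On the phase space $M = \{y = (x,\rho) \in \mathbb R^n \times \mathbb R\}$ consider the system $$\dot x = A x + b \rho + f(x,\rho), \qquad \dot \rho = \sigma \rho .$$ A solution $(x,\rho)$, defined on an open interval unbounded below, is called $\rho$-analytic if there exist $R, \varepsilon > 0$ and a real-analytic $g : (-\varepsilon,\varepsilon) \to \mathbb R^n$ with $g(0) = 0$ such that $\rho(t) \in (-\varepsilon,\varepsilon)$ and $x(t) = g(\rho(t))$ for all $t < -R$. Let $W^\rho(0) \subset M$ be the set of all initial data at time $0$ for which the corresponding solution is $\rho$-analytic. Assume that every eigenvalue $\lambda \in \mathbb C$ of $A$ satisfies $\operatorname{Re}(\lambda) \notin \sigma \mathbb N_+ = \{\sigma, 2\sigma, 3\sigma, \ldots\}$. Then: 1. $W^\rho(0)$ is a one-dimensional smooth ($C^\infty$, embedded) manifold in $M$. 2. There exist $\varepsilon > 0$ and a real-analytic $g : (-\varepsilon,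 \varepsilon) \to \mathbb R^n$ with $g(0) = 0$ such that $$\{(x,\rho) \in W^\rho(0) : \rho \in (-\varepsilon,\varepsilon)\} = \{(g(\rho),\rho) : \rho \in (-\varepsilon,\varepsilon)\}.$$ 3. For each of the three constraints $\rho > 0$, $\rho = 0$, $\rho < 0$ there exists a $\rho$-analytic solution satisfying it, and it is unique up to time translation: if $y_1$ and $y_2$ are $\rho$-analytic solutions whose $\rho$-components have the same sign (positive, zero or negative), then there is $\tau \in \mathbb R$ such that $y_1(t) = y_2(t + \tau)$ for all $t$ for which both sides are defined. -/

import Mathlib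

open Set Filter Topology
open scoped ContDiff Manifold

/-- The phase space `M = ℝⁿ × ℝ`, with points `y = (x, ρ)`. -/
abbrev PhaseSpace (n : ℕ) : Type := EuclideanSpace ℝ (Fin n) × ℝ

/-- The vector field `(x, ρ) ↦ (A x + ρ b + f (x, ρ), σ ρ)` on the phase space. -/
noncomputable def vectorField {n : ℕ} (A : Matrix (Fin n) (Fin n) ℝ)
    (b : EuclideanSpace ℝ (Fin n)) (σ : ℝ) (f : PhaseSpace n → EuclideanSpace ℝ (Fin n)) :
    PhaseSpace n → PhaseSpace n :=
  fun y => (Matrix.toEuclideanLin A y.1 + y.2 • b + f y, σ * y.2)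

/-- `y` is a `ρ`-analytic solution, on the open interval `I`, of the autonomous system with vector
field `v`: it solves the system on `I`, the interval `I` contains a half-line `(-∞, -R)`, and on
this half-line `x = g ρ` for a real-analytic `g` on some `(-ε, ε)` with `g 0 = 0`. -/
structure IsRhoAnalyticOn {n : ℕ} (v : PhaseSpace n → PhaseSpace n)
    (y : ℝ → PhaseSpace n) (I : Set ℝ) : Prop where
  isOpen : IsOpen I
  ordConnected : I.OrdConnected
  solution : IsIntegralCurveOn y (fun _ => v) I
  analytic : ∃ R > (0 : ℝ), ∃ ε > (0 : ℝ), ∃ g : ℝ → EuclideanSpace ℝ (Fin n),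
    AnalyticOnNhd ℝ g (Ioo (-ε) ε) ∧ g 0 = 0 ∧
      ∀ t < -R, t ∈ I ∧ (y t).2 ∈ Ioo (-ε) ε ∧ (y t).1 = g (y t).2

/-- `W^ρ(0)`: the set of all initial data (at time `0`) whose solution is `ρ`-analytic. -/
def rhoAnalyticSet {n : ℕ} (v : PhaseSpace n → PhaseSpace n) : Set (PhaseSpace n) :=
  {p | ∃ (y : ℝ → PhaseSpace n) (I : Set ℝ), IsRhoAnalyticOn v y I ∧ 0 ∈ I ∧ y 0 = p}

/-- `S` is a one-dimensional smooth (`C^∞`) manifold in the normed space `E`: with its subspace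
topology, it has a `C^∞` structure modelled on `ℝ` for which the inclusion `S → E` is a smooth
embedding, that is, an immersion and a topological embedding. -/
def IsSmoothCurveManifold {E : Type*} [NormedAddCommGroup E] [NormedSpace ℝ E] (S : Set E) : Prop :=
  ∃ _ : ChartedSpace ℝ S, IsManifold 𝓘(ℝ, ℝ) ∞ S ∧
    Manifold.IsSmoothEmbedding 𝓘(ℝ, ℝ) 𝓘(ℝ, E) ∞ (Subtype.val : S → E)

/-!
Since `ρ' = σ ρ`, the graph of an analytic `g` consists of pieces of orbits if and only if `g` solves
the invariance equation `σ ρ g' = A g + ρ b + f (g, ρ)`, a singular differential equation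
at `ρ = 0`. Everything rests on the fact that, in the absence of resonances, it has exactly one
analytic solution with `g 0 = 0` near `ρ = 0`.

*Existence* (`exists_analyticAt_solvesInvarianceEq`). Comparing the coefficients of `ρᵏ` gives
`(σ k - A) gₖ = δₖ₁ b + (terms in gⱼ, j < k)`, since `f` starts with quadratic terms. The operators
`σ k - A`, `k ≥ 1`, are invertible with uniformly bounded inverses (`exists_bounded_inverses`),
so the recursion defines a formal solution, and the majorant estimate that Mathlib uses for the
inverse of an analytic map shows that it converges.

*Uniqueness* (`eventuallyEq_of_solvesInvarianceEq`). If `u ρᵏ` is the lowest order term of the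
difference of two solutions, the equation gives `A u = σ k u`, which is excluded.

If a solution with `ρ ≠ 0` runs in the graph of an analytic `g` for `t → -∞`, the invariance equation
holds at the points `ρ(t)`, which accumulate at `0`, and hence near `0` by the identity theorem.
Therefore two `ρ`-analytic solutions with the same value of `ρ` at one time agree near `-∞`, and then
everywhere by uniqueness for ordinary differential equations (`IsRhoAnalyticOn.eq_of_snd_eq`). This
yields uniqueness up to time translation, and shows that `W^ρ(0)` meets each line `ρ = const` at most
once. Near `ρ = 0` the set `W^ρ(0)` is the graph of `g`; near its other points it is an orbit
parametrized by `ρ`. So it is the graph of a smooth function over an open set of values of `ρ`, which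
is an embedded curve (`isSmoothCurveManifold_of_locally_graph`).
-/

/-! ### The formal solution of the invariance equation -/

section FormalSolution

variable {E : Type*} [NormedAddCommGroup E] [NormedSpace ℝ E]

/-- The coefficients of the formal power series solution `g = ∑ gₖ ρᵏ` of
`σ ρ g' = A g + ρ b + f (g, ρ)`, where `R k` stands for the inverse of `σ k - A` and `p` for the
power series of `f`. Comparing the coefficients of `ρᵏ` determines `gₖ` from the `gⱼ` with `j < k`,
since `f` has no terms of degree less than two. The guards `j < k` only serve to make the recursion
well-founded; they are removed in `formalCoeff_eq`. -/
noncomputable def formalCoeff (p : FormalMultilinearSeries ℝ (E × ℝ) E) (R : ℕ → E →L[ℝ] E)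
    (b : E) (k : ℕ) : E :=
  if k = 0 then 0 else
    R k ((if k = 1 then b else 0) +
      ∑ c ∈ ({c : Composition k | 1 < c.length} : Finset (Composition k)),
        p c.length fun i =>
          (if _ : c.blocksFun i < k then formalCoeff p R b (c.blocksFun i) else 0,
            if c.blocksFun i = 1 then 1 else 0))
termination_by k

variable (p : FormalMultilinearSeries ℝ (E × ℝ) E) (R : ℕ → E →L[ℝ] E) (b : E)

/-- The coefficients of the curve `ρ ↦ (g ρ, ρ)`, for `g` the formal solution. -/
noncomputable def formalCurveCoeff (k : ℕ) : E × ℝ :=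
  (formalCoeff p R b k, if k = 1 then 1 else 0)

lemma formalCoeff_zero : formalCoeff p R b 0 = 0 := by
  rw [formalCoeff]; simp

lemma Composition.blocksFun_lt_of_one_lt_length {k : ℕ} {c : Composition k} (hc : 1 < c.length)
    (i : Fin c.length) : c.blocksFun i < k := by
  have hk : 0 < k := lt_of_lt_of_le (by omega) c.length_le
  refine (Composition.ne_single_iff hk).1 ?_ i
  rintro rfl
  simp at hc

lemma formalCoeff_eq {k : ℕ} (hk : k ≠ 0) :
    formalCoeff p R b k = R k ((if k = 1 then b else 0) +
      ∑ c ∈ ({c : Composition k | 1 < c.length} : Finset (Composition k)),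
        p c.length fun i => formalCurveCoeff p R b (c.blocksFun i)) := by
  rw [formalCoeff, if_neg hk]
  congr 2
  refine Finset.sum_congr rfl fun c hc => ?_
  congr 1
  funext i
  have := Composition.blocksFun_lt_of_one_lt_length (Finset.mem_filter.1 hc).2 i
  rw [dif_pos this, formalCurveCoeff]

lemma norm_formalCurveCoeff_le (k : ℕ) :
    ‖formalCurveCoeff p R b k‖ ≤ ‖formalCoeff p R b k‖ + if k = 1 then 1 else 0 := by
  rw [formalCurveCoeff, Prod.norm_def]
  refine max_le (le_add_of_nonneg_right (by split_ifs <;> simp)) ?_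
  refine le_add_of_nonneg_of_le (norm_nonneg _) ?_
  split_ifs <;> simp

/-- One step of the majorant estimate: the partial sums of `∑ ‖gₖ‖ aᵏ` are controlled by powers of
the preceding partial sum. -/
lemma sum_norm_formalCurveCoeff_le {K C r a : ℝ} (hK : 0 ≤ K) (hC : 0 ≤ C) (hr : 0 ≤ r)
    (ha : 0 ≤ a) (hR : ∀ k ≠ 0, ‖R k‖ ≤ K) (hp : ∀ m, ‖p m‖ ≤ C * r ^ m) {n : ℕ} (hn : 1 ≤ n) :
    ∑ k ∈ Finset.Ico 1 (n + 1), a ^ k * ‖formalCurveCoeff p R b k‖ ≤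
      (1 + K * ‖b‖) * a + K * C * ∑ j ∈ Finset.Ico 2 (n + 1),
        r ^ j * (∑ k ∈ Finset.Ico 1 n, a ^ k * ‖formalCurveCoeff p R b k‖) ^ j := by
  have hR' : ∀ k ≠ 0, ∀ v, ‖R k v‖ ≤ K * ‖v‖ := fun k hk v =>
    (R k).le_of_opNorm_le (hR k hk) v
  have h1 : ‖formalCurveCoeff p R b 1‖ ≤ 1 + K * ‖b‖ := by
    have h0 : formalCoeff p R b 1 = R 1 b := by
      rw [formalCoeff_eq p R b one_ne_zero, Finset.filter_false_of_mem]
      · simp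
      · intro c _
        exact not_lt.2 c.length_le
    have := norm_formalCurveCoeff_le p R b 1
    rw [h0] at this
    have := hR' 1 one_ne_zero b
    simp only [if_true] at *
    linarith
  have h2 : ∀ k ∈ Finset.Ico 2 (n + 1), a ^ k * ‖formalCurveCoeff p R b k‖ ≤
      K * C * (a ^ k * ∑ c ∈ ({c | 1 < Composition.length c}.toFinset : Finset (Composition k)),
        r ^ c.length * ∏ j, ‖formalCurveCoeff p R b (c.blocksFun j)‖) := by
    intro k hk
    have hk2 : 2 ≤ k := (Finset.mem_Ico.1 hk).1
    have hle := norm_formalCurveCoeff_le p R b k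
    rw [if_neg (by omega), add_zero, formalCoeff_eq p R b (by omega), if_neg (by omega),
      zero_add] at hle
    have hsum : ‖∑ c ∈ ({c : Composition k | 1 < c.length} : Finset (Composition k)),
        p c.length fun i => formalCurveCoeff p R b (c.blocksFun i)‖ ≤
        C * ∑ c ∈ ({c | 1 < Composition.length c}.toFinset : Finset (Composition k)),
          r ^ c.length * ∏ j, ‖formalCurveCoeff p R b (c.blocksFun j)‖ := by
      rw [Finset.mul_sum, Set.toFinset_ofPred]
      refine (norm_sum_le _ _).trans (Finset.sum_le_sum fun c _ => ?_)
      rw [← mul_assoc]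
      exact (p c.length).le_of_opNorm_le (hp _) _
    calc a ^ k * ‖formalCurveCoeff p R b k‖
        ≤ a ^ k * (K * (C * ∑ c ∈ ({c | 1 < Composition.length c}.toFinset :
            Finset (Composition k)),
            r ^ c.length * ∏ j, ‖formalCurveCoeff p R b (c.blocksFun j)‖)) := by
          gcongr
          exact hle.trans ((hR' k (by omega) _).trans (by gcongr))
      _ = _ := by ring
  rw [Finset.sum_eq_sum_Ico_succ_bot (by omega)]
  refine add_le_add (by rw [pow_one, mul_comm]; gcongr) ?_
  refine (Finset.sum_le_sum h2).trans ?_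
  rw [← Finset.mul_sum]
  refine mul_le_mul_of_nonneg_left ?_ (mul_nonneg hK hC)
  exact FormalMultilinearSeries.radius_right_inv_pos_of_radius_pos_aux1 n
    (fun k => ‖formalCurveCoeff p R b k‖) (fun _ => norm_nonneg _) hr ha

/-- The formal solution converges: its coefficients grow at most geometrically. -/
lemma exists_norm_formalCurveCoeff_le {K C r : ℝ} (hK : 0 ≤ K) (hC : 0 ≤ C) (hr : 0 ≤ r)
    (hR : ∀ k ≠ 0, ‖R k‖ ≤ K) (hp : ∀ m, ‖p m‖ ≤ C * r ^ m) :
    ∃ a > (0 : ℝ), ∃ B, ∀ k, ‖formalCurveCoeff p R b k‖ * a ^ k ≤ B := by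
  set I := 1 + K * ‖b‖ with hI
  have hI0 : 0 ≤ I := by positivity
  -- for small `a` the bound `(I + 1) a` on the partial sums reproduces itself
  obtain ⟨a, apos, ha1, ha2⟩ : ∃ a > (0 : ℝ), 2 * (K * C) * r ^ 2 * (I + 1) ^ 2 * a ≤ 1 ∧
      r * ((I + 1) * a) ≤ 1 / 2 := by
    have h1 : Tendsto (fun a : ℝ => 2 * (K * C) * r ^ 2 * (I + 1) ^ 2 * a) (𝓝 0) (𝓝 0) :=
      Continuous.tendsto' (by fun_prop) _ _ (by simp)
    have h2 : Tendsto (fun a : ℝ => r * ((I + 1) * a)) (𝓝 0) (𝓝 0) :=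
      Continuous.tendsto' (by fun_prop) _ _ (by simp)
    have h := ((h1.eventually_le_const one_pos).and
      (h2.eventually_le_const (by norm_num : (0 : ℝ) < 1 / 2)))
    obtain ⟨a, ha, hpos⟩ := ((h.filter_mono nhdsWithin_le_nhds).and
      (self_mem_nhdsWithin (s := Ioi (0 : ℝ)))).exists
    exact ⟨a, hpos, ha⟩
  have key : ∀ n, 1 ≤ n →
      ∑ k ∈ Finset.Ico 1 n, a ^ k * ‖formalCurveCoeff p R b k‖ ≤ (I + 1) * a := by
    refine Nat.le_induction ?_ ?_
    · simp only [Finset.Ico_self, Finset.sum_empty]; positivity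
    · intro n hn ih
      refine (sum_norm_formalCurveCoeff_le p R b hK hC hr apos.le hR hp hn).trans ?_
      set S := ∑ k ∈ Finset.Ico 1 n, a ^ k * ‖formalCurveCoeff p R b k‖
      have hS0 : 0 ≤ S := Finset.sum_nonneg fun _ _ => by positivity
      have hrS : r * S ≤ 1 / 2 := le_trans (by gcongr) ha2
      simp_rw [← mul_pow]
      rw [geom_sum_Ico' (ne_of_lt (hrS.trans_lt (by norm_num))) (by omega)]
      calc I * a + K * C * (((r * S) ^ 2 - (r * S) ^ (n + 1)) / (1 - r * S))
          ≤ I * a + K * C * ((r * S) ^ 2 / (1 / 2)) := by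
            gcongr
            · exact sub_le_self _ (by positivity)
            · linarith
        _ = I * a + 2 * (K * C) * (r * S) ^ 2 := by ring
        _ ≤ I * a + 2 * (K * C) * (r * ((I + 1) * a)) ^ 2 := by gcongr
        _ = I * a + (2 * (K * C) * r ^ 2 * (I + 1) ^ 2 * a) * a := by ring
        _ ≤ I * a + 1 * a := by gcongr
        _ = (I + 1) * a := by ring
  refine ⟨a, apos, (I + 1) * a, fun k => ?_⟩
  rcases Nat.eq_zero_or_pos k with rfl | hk
  · simp only [formalCurveCoeff, formalCoeff_zero]
    simp
    positivity
  · rw [mul_comm]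
    refine le_trans ?_ (key (k + 1) (by omega))
    exact Finset.single_le_sum (f := fun k => a ^ k * ‖formalCurveCoeff p R b k‖)
      (fun _ _ => by positivity) (Finset.mem_Ico.2 ⟨hk, by omega⟩)

end FormalSolution

/-! ### Existence of an analytic solution -/

section Equation

variable {E : Type*} [NormedAddCommGroup E] [NormedSpace ℝ E]

/-- At the point `ρ`, the function `g` satisfies the invariance equation
`σ ρ g' = A g + ρ b + f (g, ρ)`, which says that the vector field is tangent to the graph of `g`.
Since `deriv` is used, this is meaningful only where `g` is differentiable. -/
def SolvesInvarianceEq (A : E →L[ℝ] E) (b : E) (σ : ℝ) (f : E × ℝ → E) (g : ℝ → E) (ρ : ℝ) :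
    Prop :=
  (σ * ρ) • deriv g ρ = A (g ρ) + ρ • b + f (g ρ, ρ)

lemma hasFPowerSeriesAt_sum_mkPiRing {F : Type*} [NormedAddCommGroup F] [NormedSpace ℝ F]
    [CompleteSpace F] (c : ℕ → F) {a B : ℝ} (ha : 0 < a) (hc : ∀ k, ‖c k‖ * a ^ k ≤ B) :
    let q : FormalMultilinearSeries ℝ ℝ F := fun k =>
      ContinuousMultilinearMap.mkPiRing ℝ (Fin k) (c k)
    HasFPowerSeriesAt q.sum q 0 := by
  intro q
  refine (FormalMultilinearSeries.hasFPowerSeriesOnBall _ ?_).hasFPowerSeriesAt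
  refine lt_of_lt_of_le ?_ (FormalMultilinearSeries.le_radius_of_bound (r := ⟨a, ha.le⟩) _ B ?_)
  · exact ENNReal.coe_pos.2 ha
  · intro k
    simp only [q, ContinuousMultilinearMap.norm_mkPiRing]
    exact hc k

/-- The formal solution sums to an analytic solution of the invariance equation. Here `R k` is a
right inverse of `σ k - A`. -/
theorem exists_analyticAt_solvesInvarianceEq [CompleteSpace E] {A : E →L[ℝ] E} {b : E} {σ : ℝ}
    {f : E × ℝ → E} (hf : AnalyticAt ℝ f 0) (hf0 : f 0 = 0) (hf1 : HasFDerivAt f (0 : E × ℝ →L[ℝ] E) 0)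
    {R : ℕ → E →L[ℝ] E} {K : ℝ} (hRK : ∀ k ≠ 0, ‖R k‖ ≤ K)
    (hR : ∀ k : ℕ, k ≠ 0 → ∀ v, (σ * k) • R k v - A (R k v) = v) :
    ∃ g : ℝ → E, AnalyticAt ℝ g 0 ∧ g 0 = 0 ∧
      ∀ᶠ ρ in 𝓝 0, SolvesInvarianceEq A b σ f g ρ := by
  obtain ⟨p, hp⟩ := hf
  have hp0 : ∀ v, p 0 v = 0 := fun v => by rw [hp.coeff_zero v, hf0]
  -- only compositions of length at least two contribute to the series of `f (g, ρ)`, because the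
  -- terms of degree zero and one of `p` vanish
  have hp1 : ∀ v, p 1 v = 0 := fun v => by
    have h := hp.hasFDerivAt.unique hf1
    have h2 : (continuousMultilinearCurryFin1 ℝ (E × ℝ) E) (p 1) (v 0) = 0 := by rw [h]; rfl
    rw [← h2, continuousMultilinearCurryFin1_apply]
    congr 1
    ext i
    all_goals rw [Subsingleton.elim i 0]; rfl
  obtain ⟨C, r, hC, hr, hCr⟩ := p.le_mul_pow_of_radius_pos hp.radius_pos
  obtain ⟨a, ha, B, hB⟩ := exists_norm_formalCurveCoeff_le p R b
    ((norm_nonneg _).trans (hRK 1 one_ne_zero)) hC.le hr.le hRK hCr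
  have hBg : ∀ k, ‖formalCoeff p R b k‖ * a ^ k ≤ B := fun k =>
    le_trans (by gcongr; exact norm_fst_le (formalCurveCoeff p R b k)) (hB k)
  set q : FormalMultilinearSeries ℝ ℝ E := fun k =>
    ContinuousMultilinearMap.mkPiRing ℝ (Fin k) (formalCoeff p R b k) with hq
  set Q : FormalMultilinearSeries ℝ ℝ (E × ℝ) := fun k =>
    ContinuousMultilinearMap.mkPiRing ℝ (Fin k) (formalCurveCoeff p R b k) with hQ
  have hqg : HasFPowerSeriesAt q.sum q 0 := hasFPowerSeriesAt_sum_mkPiRing _ ha hBg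
  set g := q.sum
  have hg0 : g 0 = 0 := by
    rw [← hqg.coeff_zero (fun _ => 0)]
    simp [hq, formalCoeff_zero]
  have hqc : ∀ k, q.coeff k = formalCoeff p R b k := fun k => by
    simp [hq, FormalMultilinearSeries.coeff]
  have hQc : ∀ k, Q.coeff k = formalCurveCoeff p R b k := fun k => by
    simp [hQ, FormalMultilinearSeries.coeff]
  have hgs := hasFPowerSeriesAt_iff.1 hqg
  simp only [zero_add, hqc] at hgs
  have hid : ∀ ρ : ℝ, HasSum (fun k : ℕ => ρ ^ k • (if k = 1 then (1 : ℝ) else 0)) ρ := by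
    intro ρ
    convert hasSum_ite_eq 1 ρ using 2 with k
    split_ifs with h <;> simp [h]
  have hQG : HasFPowerSeriesAt (fun ρ => (g ρ, ρ)) Q 0 := by
    rw [hasFPowerSeriesAt_iff]
    filter_upwards [hgs] with ρ hρ
    simp only [zero_add, hQc]
    exact hρ.prodMk (hid ρ)
  have hcomp : HasFPowerSeriesAt (f ∘ fun ρ => (g ρ, ρ)) (p.comp Q) 0 := by
    refine HasFPowerSeriesAt.comp ?_ hQG
    rw [hg0]; exact hp
  have hfs := hasFPowerSeriesAt_iff.1 hcomp
  have hcc : ∀ k, (p.comp Q).coeff k =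
      ∑ c ∈ ({c : Composition k | 1 < c.length} : Finset (Composition k)),
        p c.length fun i => formalCurveCoeff p R b (c.blocksFun i) := by
    intro k
    rw [FormalMultilinearSeries.coeff, FormalMultilinearSeries.comp,
      sum_apply, Finset.sum_filter]
    refine Finset.sum_congr rfl fun c _ => ?_
    rw [FormalMultilinearSeries.compAlongComposition_apply]
    split_ifs with hc
    · congr 1
      funext i
      simp [FormalMultilinearSeries.applyComposition, hQ]
    · have : ∀ m (v : Fin m → E × ℝ), m ≤ 1 → p m v = 0 := by
        intro m v hm
        interval_cases m
        exacts [hp0 v, hp1 v]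
      exact this _ _ (not_lt.1 hc)
  -- the coefficients of the two sides of the equation agree by the choice of `formalCoeff`
  have hcoef : ∀ k : ℕ, k ≠ 0 → (σ * k) • formalCoeff p R b k = A (formalCoeff p R b k) +
      ((if k = 1 then (1 : ℝ) else 0) • b + (p.comp Q).coeff k) := by
    intro k hk
    have := hR k hk ((if k = 1 then b else 0) + (p.comp Q).coeff k)
    rw [hcc, ← formalCoeff_eq p R b hk, sub_eq_iff_eq_add', ← hcc] at this
    rw [this]
    congr 2
    split_ifs <;> simp
  have hcoef0 : (p.comp Q).coeff 0 = 0 := by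
    rw [hcc, Finset.sum_eq_zero]
    intro c hc
    have := c.length_le
    have := (Finset.mem_filter.1 hc).2
    omega
  obtain ⟨s, hs⟩ := hqg
  refine ⟨g, hs.analyticAt, hg0, ?_⟩
  -- `ρ g'(ρ)` is the Fréchet derivative of `g` at `ρ` in the direction `ρ`, so its series is the
  -- diagonal of `derivSeries`
  have hd : ∀ᶠ ρ in 𝓝 (0 : ℝ), HasSum (fun k : ℕ => (k : ℝ) • ρ ^ k • formalCoeff p R b k)
      (ρ • deriv g ρ) := by
    filter_upwards [Metric.eball_mem_nhds (0 : ℝ) hs.r_pos] with ρ hρ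
    have h1 := hs.fderiv.hasSum hρ
    have h2 := (ContinuousLinearMap.apply ℝ E ρ).hasSum h1
    rw [zero_add] at h2
    have h3 : (ContinuousLinearMap.apply ℝ E ρ) (fderiv ℝ g ρ) = ρ • deriv g ρ := by
      rw [ContinuousLinearMap.apply_apply, ← fderiv_eq_smul_deriv]
    rw [h3] at h2
    rw [← hasSum_nat_add_iff' 1]
    simp only [Finset.range_one, Finset.sum_singleton, Nat.cast_zero, zero_smul, sub_zero]
    convert h2 using 2 with k
    rw [ContinuousLinearMap.apply_apply,
      FormalMultilinearSeries.derivSeries_apply_diag, ← Nat.cast_smul_eq_nsmul ℝ]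
    simp [hq]
  filter_upwards [hgs, hfs, hd] with ρ h1 h2 h3
  simp only [zero_add, Function.comp_apply] at h2
  have hL := h3.const_smul σ
  have hRR := (A.hasSum h1).add (((hid ρ).smul_const b).add h2)
  rw [SolvesInvarianceEq, mul_smul, add_assoc]
  refine hL.unique ?_
  convert hRR using 2 with k
  rcases eq_or_ne k 0 with rfl | hk
  · simp [hcoef0, formalCoeff_zero]
  · have h := congrArg (fun v => ρ ^ k • v) (hcoef k hk)
    simp only [smul_add] at h
    simp only [map_smul, smul_assoc]
    rw [← h]
    simp only [smul_smul]
    congr 1; ring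

end Equation

/-! ### Uniqueness of the analytic solution -/

section Uniqueness

variable {E : Type*} [NormedAddCommGroup E] [NormedSpace ℝ E]

/-- The invariance equation has at most one analytic solution germ: if `u ρⁿ` is the lowest order
term of the difference of two solutions, comparison of the terms of order `n` shows `A u = σ n u`. -/
theorem eventuallyEq_of_solvesInvarianceEq [CompleteSpace E] {A : E →L[ℝ] E} {b : E} {σ : ℝ}
    {f : E × ℝ → E} (hf : HasStrictFDerivAt f (0 : E × ℝ →L[ℝ] E) 0)
    (hA : ∀ k : ℕ, k ≠ 0 → ∀ v, A v = (σ * k) • v → v = 0) {g₁ g₂ : ℝ → E}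
    (hg₁ : AnalyticAt ℝ g₁ 0) (hg₂ : AnalyticAt ℝ g₂ 0) (h₁ : g₁ 0 = 0) (h₂ : g₂ 0 = 0)
    (he₁ : ∀ᶠ ρ in 𝓝 0, SolvesInvarianceEq A b σ f g₁ ρ)
    (he₂ : ∀ᶠ ρ in 𝓝 0, SolvesInvarianceEq A b σ f g₂ ρ) : g₁ =ᶠ[𝓝 0] g₂ := by
  by_contra hne
  have hne' : ¬ ∀ᶠ ρ in 𝓝 (0 : ℝ), (g₁ - g₂) ρ = 0 :=
    fun h => hne (h.mono fun ρ hρ => sub_eq_zero.1 hρ)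
  obtain ⟨n, u, hu, hu0, hgu⟩ :=
    (hg₁.sub hg₂).exists_eventuallyEq_pow_smul_nonzero_iff.2 hne'
  simp only [sub_zero] at hgu
  have hn : n ≠ 0 := by
    rintro rfl
    apply hu0
    simpa [h₁, h₂] using hgu.self_of_nhds.symm
  refine hu0 (hA n hn _ ?_)
  set w : ℝ → E := fun ρ => (σ * n) • u ρ + (σ * ρ) • deriv u ρ - A (u ρ) with hw
  have hwc : ContinuousAt w 0 := by
    have := hu.deriv.continuousAt
    have := hu.continuousAt
    fun_prop
  have hlim : Tendsto (fun ρ : ℝ => ((g₁ ρ, ρ), (g₂ ρ, ρ))) (𝓝 0) (𝓝 ((0 : E × ℝ), (0 : E × ℝ))) := by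
    have c₁ := hg₁.continuousAt.tendsto
    have c₂ := hg₂.continuousAt.tendsto
    rw [h₁] at c₁
    rw [h₂] at c₂
    exact (c₁.prodMk_nhds tendsto_id).prodMk_nhds (c₂.prodMk_nhds tendsto_id)
  have hlo := hf.isLittleO.comp_tendsto hlim
  -- the difference of the nonlinear terms is `ρⁿ w`, and it is of lower order than `ρⁿ u`
  have hwu : w =o[𝓝[≠] 0] u := by
    rw [Asymptotics.isLittleO_iff]
    intro c hc
    have hlo' := (Asymptotics.isLittleO_iff.1 hlo) hc
    have hev := ((he₁.and he₂).and (hlo'.and (hgu.eventually_nhds.and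
      (hu.eventually_analyticAt.and (hg₁.eventually_analyticAt.and
        hg₂.eventually_analyticAt))))).filter_mono (nhdsWithin_le_nhds (s := {0}ᶜ))
    filter_upwards [hev, self_mem_nhdsWithin] with ρ hρ hρ0
    obtain ⟨⟨e₁, e₂⟩, hl, hg, hua, ha₁, ha₂⟩ := hρ
    have hd : deriv g₁ ρ - deriv g₂ ρ = (n * ρ ^ (n - 1)) • u ρ + ρ ^ n • deriv u ρ := by
      have hg' : (g₁ - g₂) =ᶠ[𝓝 ρ] fun ρ => ρ ^ n • u ρ := hg
      have := hg'.deriv_eq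
      rw [deriv_sub ha₁.differentiableAt ha₂.differentiableAt] at this
      rw [this]
      have := (hasDerivAt_pow n ρ).smul hua.differentiableAt.hasDerivAt
      exact this.deriv.trans (add_comm _ _)
    have hgρ : g₁ ρ - g₂ ρ = ρ ^ n • u ρ := hg.self_of_nhds
    have hfw : f (g₁ ρ, ρ) - f (g₂ ρ, ρ) = ρ ^ n • w ρ := by
      have e : (σ * ρ) • (deriv g₁ ρ - deriv g₂ ρ) =
          A (g₁ ρ - g₂ ρ) + (f (g₁ ρ, ρ) - f (g₂ ρ, ρ)) := by
        rw [smul_sub, e₁, e₂, map_sub]; abel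
      rw [hd, hgρ, map_smul] at e
      rw [← sub_eq_iff_eq_add'] at e
      rw [← e, hw]
      simp only [smul_add, smul_sub, smul_smul]
      congr 3
      · obtain ⟨m, rfl⟩ := Nat.exists_eq_succ_of_ne_zero hn
        simp only [Nat.succ_eq_add_one, Nat.add_sub_cancel]
        ring
      · ring
    simp only [Function.comp_apply, zero_apply, sub_zero, hfw, Prod.mk_sub_mk, sub_self, hgρ] at hl
    rw [Prod.norm_mk, norm_zero, max_eq_left (norm_nonneg _), norm_smul, norm_smul,
      mul_left_comm] at hl
    exact le_of_mul_le_mul_left hl (by rw [norm_pow]; exact pow_pos (norm_pos_iff.2 hρ0) n)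
  have h0 : Tendsto w (𝓝[≠] 0) (𝓝 0) := by
    rw [← Asymptotics.isLittleO_one_iff ℝ]
    exact hwu.trans_isBigO ((hu.continuousAt.tendsto.isBigO_one ℝ).mono nhdsWithin_le_nhds)
  have := tendsto_nhds_unique (hwc.tendsto.mono_left nhdsWithin_le_nhds) h0
  simp only [hw, mul_zero, zero_smul, add_zero] at this
  exact (sub_eq_zero.1 this).symm

end Uniqueness

/-! ### Consequences of the nonresonance condition -/

section Nonresonance

variable {E : Type*} [NormedAddCommGroup E] [NormedSpace ℝ E] [FiniteDimensional ℝ E]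

/-- In the absence of resonances the operators `σ k - A`, `k ≥ 1`, have uniformly bounded
inverses. -/
lemma exists_bounded_inverses {A : E →L[ℝ] E} {σ : ℝ} (hσ : 0 < σ)
    (hA : ∀ k : ℕ, k ≠ 0 → ∀ v, A v = (σ * k) • v → v = 0) :
    ∃ (R : ℕ → E →L[ℝ] E) (K : ℝ), (∀ k ≠ 0, ‖R k‖ ≤ K) ∧
      ∀ k : ℕ, k ≠ 0 → ∀ v, (σ * k) • R k v - A (R k v) = v := by
  have hex : ∀ k : ℕ, ∃ R : E →L[ℝ] E, k ≠ 0 → ∀ v, (σ * k) • R v - A (R v) = v := by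
    intro k
    by_cases hk : k = 0
    · exact ⟨0, fun h => absurd hk h⟩
    set T : E →ₗ[ℝ] E := (σ * k) • LinearMap.id - (A : E →ₗ[ℝ] E) with hT
    have hinj : Function.Injective T := by
      refine (injective_iff_map_eq_zero T).2 fun v hv => hA k hk v ?_
      exact (sub_eq_zero.1 hv).symm
    let e := LinearEquiv.ofInjectiveEndo T hinj
    refine ⟨LinearMap.toContinuousLinearMap (e.symm : E →ₗ[ℝ] E), fun _ v => ?_⟩
    have h : T (e.symm v) = v := e.apply_symm_apply v
    simpa [hT] using h
  choose R hR using hex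
  obtain ⟨N, hN⟩ := exists_nat_gt ((‖A‖ + 1) / σ)
  refine ⟨R, 1 + ∑ k ∈ Finset.range N, ‖R k‖, fun k hk => ?_, hR⟩
  have hsum : 0 ≤ ∑ k ∈ Finset.range N, ‖R k‖ := Finset.sum_nonneg fun _ _ => norm_nonneg _
  -- for `k ≥ N` one has `σ k ≥ ‖A‖ + 1`, whence `‖(σ k - A) v‖ ≥ ‖v‖`
  by_cases hkN : k < N
  · have := Finset.single_le_sum (f := fun k => ‖R k‖) (fun _ _ => norm_nonneg _)
      (Finset.mem_range.2 hkN)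
    linarith
  · refine ContinuousLinearMap.opNorm_le_bound _ (by positivity) fun v => ?_
    have hkσ : ‖A‖ + 1 ≤ σ * k := by
      rw [div_lt_iff₀ hσ] at hN
      have : (N : ℝ) ≤ k := by exact_mod_cast not_lt.1 hkN
      nlinarith
    have h1 : ‖(σ * k) • R k v‖ ≤ ‖v‖ + ‖A‖ * ‖R k v‖ := by
      rw [sub_eq_iff_eq_add.1 (hR k hk v)]
      exact (norm_add_le _ _).trans (by gcongr; exact A.le_opNorm _)
    rw [norm_smul, Real.norm_of_nonneg (by positivity)] at h1
    have h2 : ‖R k v‖ ≤ ‖v‖ := by nlinarith [norm_nonneg (R k v)]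
    nlinarith [norm_nonneg v]

/-- The eigenvalue condition, read over the reals: `σ k` is not an eigenvalue of `A`. -/
lemma eq_zero_of_toEuclideanLin_eq_smul {n : ℕ} {A : Matrix (Fin n) (Fin n) ℝ} {σ : ℝ}
    (hA : ∀ z : ℂ, Module.End.HasEigenvalue (Matrix.toLin' (A.map Complex.ofReal)) z →
      ∀ k : ℕ, 0 < k → z.re ≠ σ * k) (k : ℕ) (hk : k ≠ 0) (v : EuclideanSpace ℝ (Fin n))
    (hv : Matrix.toEuclideanLin A v = (σ * k) • v) : v = 0 := by
  by_contra hne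
  refine hA ((σ * k : ℝ) : ℂ) ?_ k (Nat.pos_of_ne_zero hk) (Complex.ofReal_re _)
  refine Module.End.hasEigenvalue_of_hasEigenvector (x := fun i => (v i : ℂ)) ⟨?_, ?_⟩
  · rw [Module.End.mem_eigenspace_iff]
    ext i
    have h := congrArg (fun w : EuclideanSpace ℝ (Fin n) => w i) hv
    simp only [Matrix.toEuclideanLin, PiLp.smul_apply, smul_eq_mul] at h
    simp only [Matrix.toLin'_apply, Matrix.mulVec, dotProduct, Matrix.map_apply, Pi.smul_apply,
      smul_eq_mul]
    rw [← Complex.ofReal_mul, ← h]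
    simp [Matrix.mulVec, dotProduct]
  · intro h
    apply hne
    ext i
    have := congrFun h i
    simpa using this

end Nonresonance

/-! ### Integral curves -/

section ODE

variable {F : Type*} [NormedAddCommGroup F] [NormedSpace ℝ F]

/-- Integral curves of a `C¹` vector field that agree at one time agree on the whole interval. -/
lemma eqOn_of_hasDerivAt_of_contDiff {v : F → F} (hv : ContDiff ℝ 1 v) {I : Set ℝ} (hI : IsOpen I)
    (hI' : I.OrdConnected) {y₁ y₂ : ℝ → F} (h₁ : ∀ t ∈ I, HasDerivAt y₁ (v (y₁ t)) t)
    (h₂ : ∀ t ∈ I, HasDerivAt y₂ (v (y₂ t)) t) {t₀ : ℝ} (ht₀ : t₀ ∈ I) (h₀ : y₁ t₀ = y₂ t₀) :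
    EqOn y₁ y₂ I := by
  intro t ht
  obtain ⟨a, ha, haI⟩ : ∃ a < min t t₀, a ∈ I := by
    have hm : min t t₀ ∈ I := by rcases min_choice t t₀ with h | h <;> rwa [h]
    exact (((hI.eventually_mem hm).filter_mono nhdsWithin_le_nhds).and
      (eventually_mem_nhdsWithin (s := Iio (min t t₀)))).exists.imp fun _ h => ⟨h.2, h.1⟩
  obtain ⟨c, hc, hcI⟩ : ∃ c > max t t₀, c ∈ I := by
    have hm : max t t₀ ∈ I := by rcases max_choice t t₀ with h | h <;> rwa [h]
    exact (((hI.eventually_mem hm).filter_mono nhdsWithin_le_nhds).and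
      (eventually_mem_nhdsWithin (s := Ioi (max t t₀)))).exists.imp fun _ h => ⟨h.2, h.1⟩
  have hac : Icc a c ⊆ I := hI'.out haI hcI
  have hc₁ : ContinuousOn y₁ (Icc a c) := fun s hs =>
    (h₁ s (hac hs)).continuousAt.continuousWithinAt
  have hc₂ : ContinuousOn y₂ (Icc a c) := fun s hs =>
    (h₂ s (hac hs)).continuousAt.continuousWithinAt
  obtain ⟨K, hK⟩ := LocallyLipschitzOn.exists_lipschitzOnWith_of_compact
    ((isCompact_Icc.image_of_continuousOn hc₁).union (isCompact_Icc.image_of_continuousOn hc₂))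
    hv.locallyLipschitz.locallyLipschitzOn
  rw [lt_min_iff] at ha
  rw [gt_iff_lt, max_lt_iff] at hc
  exact ODE_solution_unique_of_mem_Ioo (v := fun _ => v) (fun _ _ => hK) ⟨ha.2, hc.2⟩
    (fun s hs => ⟨h₁ s (hac (Ioo_subset_Icc_self hs)),
      Or.inl (mem_image_of_mem _ (Ioo_subset_Icc_self hs))⟩)
    (fun s hs => ⟨h₂ s (hac (Ioo_subset_Icc_self hs)),
      Or.inr (mem_image_of_mem _ (Ioo_subset_Icc_self hs))⟩) h₀ ⟨ha.1, hc.1⟩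

/-- Integral curves of a smooth vector field are smooth. -/
lemma contDiffOn_of_hasDerivAt {v : F → F} (hv : ContDiff ℝ ∞ v) {I : Set ℝ} (hI : IsOpen I)
    {y : ℝ → F} (h : ∀ t ∈ I, HasDerivAt y (v (y t)) t) : ContDiffOn ℝ ∞ y I := by
  rw [contDiffOn_infty]
  intro k
  induction k with
  | zero => exact contDiffOn_zero.2 fun t ht => (h t ht).continuousAt.continuousWithinAt
  | succ k ih =>
    push_cast
    rw [contDiffOn_succ_iff_deriv_of_isOpen hI]
    refine ⟨fun t ht => (h t ht).differentiableAt.differentiableWithinAt, by simp, ?_⟩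
    refine ContDiffOn.congr ?_ fun t ht => (h t ht).deriv
    exact (hv.of_le (by exact_mod_cast le_top)).comp_contDiffOn ih

end ODE

/-! ### Solutions that are analytic in `ρ` -/

section RhoAnalytic

variable {n : ℕ} {A : Matrix (Fin n) (Fin n) ℝ} {b : EuclideanSpace ℝ (Fin n)} {σ : ℝ}
  {f : PhaseSpace n → EuclideanSpace ℝ (Fin n)} {y : ℝ → PhaseSpace n} {I : Set ℝ}

lemma contDiff_vectorField (hf : AnalyticOnNhd ℝ f univ) {k : WithTop ℕ∞} :
    ContDiff ℝ k (vectorField A b σ f) := by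
  have hf' : ContDiff ℝ k f := hf.contDiff
  have hA : ContDiff ℝ k (LinearMap.toContinuousLinearMap (Matrix.toEuclideanLin A)) :=
    ContinuousLinearMap.contDiff _
  have hA' : ContDiff ℝ k (fun y : PhaseSpace n => Matrix.toEuclideanLin A y.1) :=
    hA.comp contDiff_fst
  unfold vectorField
  fun_prop

namespace IsRhoAnalyticOn

lemma hasDerivAt {v : PhaseSpace n → PhaseSpace n} (h : IsRhoAnalyticOn v y I) {t : ℝ}
    (ht : t ∈ I) : HasDerivAt y (v (y t)) t :=
  (h.solution t ht).hasDerivAt (h.isOpen.mem_nhds ht)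

lemma eventually_mem {v : PhaseSpace n → PhaseSpace n} (h : IsRhoAnalyticOn v y I) :
    ∀ᶠ t in atBot, t ∈ I := by
  obtain ⟨R, -, ε, -, g, -, -, hg⟩ := h.analytic
  filter_upwards [eventually_lt_atBot (-R)] with t ht using (hg t ht).1

lemma translate {v : PhaseSpace n → PhaseSpace n} (h : IsRhoAnalyticOn v y I) (τ : ℝ) :
    IsRhoAnalyticOn v (fun t => y (t + τ)) ((· + τ) ⁻¹' I) where
  isOpen := h.isOpen.preimage (continuous_id.add continuous_const)
  ordConnected := h.ordConnected.preimage_mono (fun _ _ hst => by simpa using hst)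
  solution t ht := ((h.hasDerivAt ht).comp_add_const t τ).hasDerivWithinAt
  analytic := by
    obtain ⟨R, hR, ε, hε, g, hg, hg0, hgI⟩ := h.analytic
    exact ⟨R + |τ|, by positivity, ε, hε, g, hg, hg0, fun t ht =>
      hgI (t + τ) (by linarith [le_abs_self τ])⟩

/-- The `ρ`-component of a solution is `ρ(s) exp (σ (t - s))`. -/
lemma snd_eq (h : IsRhoAnalyticOn (vectorField A b σ f) y I) {s t : ℝ} (hs : s ∈ I) (ht : t ∈ I) :
    (y t).2 = (y s).2 * Real.exp (σ * (t - s)) := by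
  have hd : ∀ t, HasDerivAt (fun t => (y s).2 * Real.exp (σ * (t - s)))
      (σ * ((y s).2 * Real.exp (σ * (t - s)))) t := by
    intro t
    exact (((((hasDerivAt_id' t).sub_const s).const_mul σ).exp).const_mul (y s).2).congr_deriv
      (by ring)
  refine eqOn_of_hasDerivAt_of_contDiff (v := fun ρ : ℝ => σ * ρ) (by fun_prop) h.isOpen
    h.ordConnected (y₁ := fun t => (y t).2) (fun t ht => (h.hasDerivAt ht).snd)
    (fun t _ => hd t) hs (by simp) ht

lemma tendsto_snd (hσ : 0 < σ) (h : IsRhoAnalyticOn (vectorField A b σ f) y I) :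
    Tendsto (fun t => (y t).2) atBot (𝓝 0) := by
  obtain ⟨s, hs⟩ := h.eventually_mem.exists
  have : Tendsto (fun t => (y s).2 * Real.exp (σ * (t - s))) atBot (𝓝 ((y s).2 * 0)) := by
    refine Tendsto.const_mul _ (Real.tendsto_exp_atBot.comp ?_)
    exact (tendsto_atBot_add_const_right _ (-s) tendsto_id).const_mul_atBot hσ
  rw [mul_zero] at this
  refine this.congr' ?_
  filter_upwards [h.eventually_mem] with t ht using (h.snd_eq hs ht).symm

end IsRhoAnalyticOn

/-- The solution that runs in the graph of a solution `g` of the invariance equation. -/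
lemma isRhoAnalyticOn_graph (hσ : 0 < σ) {ε : ℝ} (hε : 0 < ε) {g : ℝ → EuclideanSpace ℝ (Fin n)}
    (hg : AnalyticOnNhd ℝ g (Ioo (-ε) ε)) (hg0 : g 0 = 0)
    (hsol : ∀ ρ ∈ Ioo (-ε) ε, SolvesInvarianceEq
      (LinearMap.toContinuousLinearMap (Matrix.toEuclideanLin A)) b σ f g ρ) (ρ₀ : ℝ) :
    IsRhoAnalyticOn (vectorField A b σ f)
      (fun t => (g (ρ₀ * Real.exp (σ * t)), ρ₀ * Real.exp (σ * t)))
      {t | ρ₀ * Real.exp (σ * t) ∈ Ioo (-ε) ε} where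
  isOpen := isOpen_Ioo.preimage (by fun_prop : Continuous fun t => ρ₀ * Real.exp (σ * t))
  ordConnected := by
    refine IsLowerSet.ordConnected fun s t hts hs => ?_
    have hle : Real.exp (σ * t) ≤ Real.exp (σ * s) :=
      Real.exp_le_exp.2 (by gcongr)
    simp only [mem_ofPred_eq, mem_Ioo, ← abs_lt, abs_mul, Real.abs_exp] at hs ⊢
    exact lt_of_le_of_lt (by gcongr) hs
  solution t ht := by
    have hd : HasDerivAt (fun t => ρ₀ * Real.exp (σ * t)) (σ * (ρ₀ * Real.exp (σ * t))) t :=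
      ((((hasDerivAt_id' t).const_mul σ).exp).const_mul ρ₀).congr_deriv (by ring)
    have hgd := (hg _ ht).differentiableAt.hasDerivAt.scomp t hd
    refine HasDerivAt.hasDerivWithinAt ?_
    exact (hgd.prodMk hd).congr_deriv (Prod.ext (hsol _ ht) rfl)
  analytic := by
    have hev : ∀ᶠ t in atBot, ρ₀ * Real.exp (σ * t) ∈ Ioo (-ε) ε := by
      have : Tendsto (fun t => ρ₀ * Real.exp (σ * t)) atBot (𝓝 (ρ₀ * 0)) :=
        Tendsto.const_mul _ (Real.tendsto_exp_atBot.comp (tendsto_id.const_mul_atBot hσ))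
      rw [mul_zero] at this
      exact this (Ioo_mem_nhds (by linarith) hε)
    obtain ⟨R, hR⟩ := eventually_atBot.1 hev
    refine ⟨max 1 (-R), by positivity, ε, hε, g, hg, hg0, fun t ht => ?_⟩
    have := hR t (by linarith [le_max_right 1 (-R)])
    exact ⟨this, this, rfl⟩

/-- If a solution runs, for `t → -∞`, in the graph of an analytic `g`, then `g` solves the
invariance equation: it does so at the points `ρ(t)`, which accumulate at `0`. -/
lemma IsRhoAnalyticOn.eventually_solvesInvarianceEq (hσ : 0 < σ) (hf : AnalyticOnNhd ℝ f univ)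
    (h : IsRhoAnalyticOn (vectorField A b σ f) y I) {s : ℝ} (hs : s ∈ I) (hs0 : (y s).2 ≠ 0)
    {R : ℝ} {g : ℝ → EuclideanSpace ℝ (Fin n)} (hg : AnalyticAt ℝ g 0)
    (hgI : ∀ t < -R, t ∈ I ∧ (y t).1 = g (y t).2) :
    ∀ᶠ ρ in 𝓝 0, SolvesInvarianceEq
      (LinearMap.toContinuousLinearMap (Matrix.toEuclideanLin A)) b σ f g ρ := by
  have hl : AnalyticAt ℝ (fun ρ => (σ * ρ) • deriv g ρ) 0 := by
    have := hg.deriv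
    fun_prop
  have hr : AnalyticAt ℝ (fun ρ => LinearMap.toContinuousLinearMap (Matrix.toEuclideanLin A) (g ρ)
      + ρ • b + f (g ρ, ρ)) 0 := by
    have h1 : AnalyticAt ℝ (fun ρ => f (g ρ, ρ)) 0 :=
      (hf _ (mem_univ _)).comp_of_eq (hg.prod analyticAt_id) rfl
    have h2 : AnalyticAt ℝ (fun ρ =>
        LinearMap.toContinuousLinearMap (Matrix.toEuclideanLin A) (g ρ)) 0 :=
      (ContinuousLinearMap.analyticAt _ _).comp hg
    exact (h2.add (analyticAt_id.smul analyticAt_const)).add h1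
  refine (hl.frequently_eq_iff_eventually_eq hr).1 ?_
  have hne : ∀ t ∈ I, (y t).2 ≠ 0 := fun t ht => by
    rw [h.snd_eq hs ht]
    exact mul_ne_zero hs0 (Real.exp_ne_zero _)
  have htend : Tendsto (fun t => (y t).2) atBot (𝓝[≠] 0) :=
    tendsto_nhdsWithin_iff.2 ⟨h.tendsto_snd hσ, h.eventually_mem.mono hne⟩
  refine htend.frequently (Eventually.frequently ?_)
  filter_upwards [eventually_lt_atBot (-R),
    (h.tendsto_snd hσ).eventually hg.eventually_analyticAt] with t ht hgt
  have hd := h.hasDerivAt (hgI t ht).1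
  have h1 := hgt.differentiableAt.hasDerivAt.scomp t hd.snd
  have h2 : HasDerivAt (fun t => (y t).1) (vectorField A b σ f (y t)).1 t := hd.fst
  have heq : (fun t => (y t).1) =ᶠ[𝓝 t] g ∘ fun t => (y t).2 := by
    filter_upwards [Iio_mem_nhds ht] with u hu using (hgI u hu).2
  have h3 := h2.unique (h1.congr_of_eventuallyEq heq)
  have h4 : (g (y t).2, (y t).2) = y t := by rw [← (hgI t ht).2]
  rw [h4, ← (hgI t ht).2]
  exact h3.symm

/-- A `ρ`-analytic solution is determined by the value of `ρ` at one time: two of them with the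
same value agree near `-∞`, hence wherever both are defined. -/
theorem IsRhoAnalyticOn.eq_of_snd_eq (hσ : 0 < σ) (hf : AnalyticOnNhd ℝ f univ)
    (hf' : HasStrictFDerivAt f (0 : PhaseSpace n →L[ℝ] EuclideanSpace ℝ (Fin n)) 0)
    (hA : ∀ k : ℕ, k ≠ 0 → ∀ v, Matrix.toEuclideanLin A v = (σ * k) • v → v = 0)
    {y₁ y₂ : ℝ → PhaseSpace n} {I₁ I₂ : Set ℝ}
    (h₁ : IsRhoAnalyticOn (vectorField A b σ f) y₁ I₁)
    (h₂ : IsRhoAnalyticOn (vectorField A b σ f) y₂ I₂) {s : ℝ} (hs₁ : s ∈ I₁) (hs₂ : s ∈ I₂)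
    (hs : (y₁ s).2 = (y₂ s).2) : EqOn y₁ y₂ (I₁ ∩ I₂) := by
  have hρ : ∀ t ∈ I₁ ∩ I₂, (y₁ t).2 = (y₂ t).2 := fun t ht => by
    rw [h₁.snd_eq hs₁ ht.1, h₂.snd_eq hs₂ ht.2, hs]
  have hev : ∀ᶠ t in atBot, t ∈ I₁ ∩ I₂ := h₁.eventually_mem.and h₂.eventually_mem
  suffices ∃ t ∈ I₁ ∩ I₂, (y₁ t).1 = (y₂ t).1 by
    obtain ⟨t, ht, hxt⟩ := this
    exact eqOn_of_hasDerivAt_of_contDiff (contDiff_vectorField hf) (h₁.isOpen.inter h₂.isOpen)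
      (h₁.ordConnected.inter h₂.ordConnected) (fun u hu => h₁.hasDerivAt hu.1)
      (fun u hu => h₂.hasDerivAt hu.2) ht (Prod.ext hxt (hρ t ht))
  obtain ⟨R₁, -, ε₁, hε₁, g₁, hg₁, hg₁0, hgI₁⟩ := h₁.analytic
  obtain ⟨R₂, -, ε₂, hε₂, g₂, hg₂, hg₂0, hgI₂⟩ := h₂.analytic
  have ha₁ : AnalyticAt ℝ g₁ 0 := hg₁ 0 ⟨by linarith, hε₁⟩
  have ha₂ : AnalyticAt ℝ g₂ 0 := hg₂ 0 ⟨by linarith, hε₂⟩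
  -- if `ρ` vanishes, both solutions are `0` near `-∞`; otherwise `g₁` and `g₂` solve the invariance
  -- equation and hence have the same germ
  have hgg : ∀ᶠ t in atBot, g₁ (y₁ t).2 = g₂ (y₁ t).2 := by
    by_cases h0 : (y₁ s).2 = 0
    · filter_upwards [h₁.eventually_mem] with t ht
      rw [h₁.snd_eq hs₁ ht, h0, zero_mul, hg₁0, hg₂0]
    · refine (h₁.tendsto_snd hσ).eventually (eventuallyEq_of_solvesInvarianceEq
        (A := LinearMap.toContinuousLinearMap (Matrix.toEuclideanLin A)) (b := b) hf' hA ha₁ ha₂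
        hg₁0 hg₂0 ?_ ?_)
      · exact h₁.eventually_solvesInvarianceEq hσ hf hs₁ h0 ha₁
          fun t ht => ⟨(hgI₁ t ht).1, (hgI₁ t ht).2.2⟩
      · exact h₂.eventually_solvesInvarianceEq hσ hf hs₂ (hs ▸ h0) ha₂
          fun t ht => ⟨(hgI₂ t ht).1, (hgI₂ t ht).2.2⟩
  obtain ⟨t, ht, hgt, ht₁, ht₂⟩ := (hev.and (hgg.and
    ((eventually_lt_atBot (-R₁)).and (eventually_lt_atBot (-R₂))))).exists
  refine ⟨t, ht, ?_⟩
  rw [(hgI₁ t ht₁).2.2, (hgI₂ t ht₂).2.2, hgt, hρ t ht]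

end RhoAnalytic

/-! ### Graphs as one-dimensional manifolds -/

section Graph

variable {E : Type*} [NormedAddCommGroup E] [NormedSpace ℝ E]

/-- The shear `(x, ρ) ↦ (x - G ρ, ρ)` of `E × J`, a chart which flattens the graph of `G`. -/
def shearChart (J : Set ℝ) (hJ : IsOpen J) (G : ℝ → E) (hG : ContinuousOn G J) :
    OpenPartialHomeomorph (E × ℝ) (E × ℝ) where
  toFun q := (q.1 - G q.2, q.2)
  invFun q := (q.1 + G q.2, q.2)
  source := univ ×ˢ J
  target := univ ×ˢ J
  map_source' _ h := h
  map_target' _ h := h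
  left_inv' _ _ := by simp
  right_inv' _ _ := by simp
  open_source := isOpen_univ.prod hJ
  open_target := isOpen_univ.prod hJ
  continuousOn_toFun :=
    (continuousOn_fst.sub (hG.comp continuousOn_snd fun _ h => h.2)).prodMk continuousOn_snd
  continuousOn_invFun :=
    (continuousOn_fst.add (hG.comp continuousOn_snd fun _ h => h.2)).prodMk continuousOn_snd

/-- The graph of a smooth function over a nonempty open set is a one-dimensional manifold. -/
theorem isSmoothCurveManifold_graph {J : Set ℝ} (hJ : IsOpen J) (hne : J.Nonempty) {G : ℝ → E}
    (hG : ContDiffOn ℝ ∞ G J) :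
    IsSmoothCurveManifold ((fun ρ => (G ρ, ρ)) '' J) := by
  set S : Set (E × ℝ) := (fun ρ => (G ρ, ρ)) '' J with hS
  have hmem : ∀ p : S, p.1.2 ∈ J ∧ p.1 = (G p.1.2, p.1.2) := by
    rintro ⟨_, ρ, hρ, rfl⟩
    exact ⟨hρ, rfl⟩
  have : Nonempty S := (hne.image _).to_subtype
  have hcont : Continuous fun ρ : J => (⟨(G ρ, ρ), mem_image_of_mem _ ρ.2⟩ : S) := by
    have := hG.continuousOn.domRestrict
    exact (Continuous.prodMk this continuous_subtype_val).subtype_mk _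
  let e : S ≃ₜ J :=
    { toFun := fun p => ⟨p.1.2, (hmem p).1⟩
      invFun := fun ρ => ⟨(G ρ, ρ), mem_image_of_mem _ ρ.2⟩
      left_inv := fun p => Subtype.ext (hmem p).2.symm
      right_inv := fun _ => rfl
      continuous_toFun := by fun_prop
      continuous_invFun := hcont }
  have hopen : IsOpenEmbedding fun p : S => p.1.2 :=
    hJ.isOpenEmbedding_subtypeVal.comp e.isOpenEmbedding
  let _ : ChartedSpace ℝ S := hopen.singletonChartedSpace
  have : IsManifold 𝓘(ℝ, ℝ) ∞ S := hopen.isManifold_singleton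
  refine ⟨inferInstance, inferInstance, ⟨?_, IsEmbedding.subtypeVal⟩⟩
  refine Manifold.IsImmersionOfComplement.isImmersion (F := E) fun p => ?_
  have hshear : shearChart J hJ G hG.continuousOn ∈
      IsManifold.maximalAtlas 𝓘(ℝ, E × ℝ) ∞ (E × ℝ) := by
    refine StructureGroupoid.mem_maximalAtlas_of_mem_groupoid _ ?_
    have hGs : ContDiffOn ℝ ∞ (fun q : E × ℝ => G q.2) (univ ×ˢ J) :=
      hG.comp contDiff_snd.contDiffOn fun _ h => h.2
    rw [contDiffGroupoid, mem_groupoid_of_pregroupoid]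
    constructor
    · simp only [contDiffPregroupoid, modelWithCornersSelf_coe,
        modelWithCornersSelf_coe_symm, Function.comp_id, Function.id_comp, preimage_id, range_id,
        inter_univ]
      exact (contDiffOn_fst.sub hGs).prodMk contDiffOn_snd
    · simp only [contDiffPregroupoid, modelWithCornersSelf_coe,
        modelWithCornersSelf_coe_symm, Function.comp_id, Function.id_comp, preimage_id, range_id,
        inter_univ]
      exact (contDiffOn_fst.add hGs).prodMk contDiffOn_snd
  refine Manifold.IsImmersionAtOfComplement.mk_of_charts
    (ContinuousLinearEquiv.prodComm ℝ ℝ E) (chartAt ℝ p)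
    (shearChart J hJ G hG.continuousOn) (mem_chart_source ℝ p) ⟨mem_univ _, (hmem p).1⟩
    (IsManifold.chart_mem_maximalAtlas p) hshear (fun q _ => ⟨mem_univ _, (hmem q).1⟩) ?_
  -- in the charts `(x, ρ) ↦ ρ` and `shearChart` the inclusion is `u ↦ (0, u)`
  intro u hu
  set q : S := ((chartAt ℝ p).extend 𝓘(ℝ, ℝ)).symm u with hq
  have hqu : q.1.2 = u := ((chartAt ℝ p).extend 𝓘(ℝ, ℝ)).right_inv hu
  show (q.1.1 - G q.1.2, q.1.2) = ((0 : E), u)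
  have h1 : q.1.1 = G q.1.2 := congrArg Prod.fst (hmem q).2
  rw [h1, sub_self, hqu]

/-- A set that is locally the graph of a smooth function of `ρ`, and meets every line `ρ = const`
at most once, is a one-dimensional manifold. -/
theorem isSmoothCurveManifold_of_locally_graph {S : Set (E × ℝ)} (hne : S.Nonempty)
    (hinj : InjOn Prod.snd S)
    (hloc : ∀ p ∈ S, ∃ U : Set ℝ, IsOpen U ∧ p.2 ∈ U ∧ ∃ φ : ℝ → E, ContDiffOn ℝ ∞ φ U ∧
      ∀ ρ ∈ U, (φ ρ, ρ) ∈ S) : IsSmoothCurveManifold S := by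
  have hex : ∀ ρ ∈ Prod.snd '' S, ∃ x : E, (x, ρ) ∈ S := by
    rintro _ ⟨p, hp, rfl⟩
    exact ⟨p.1, hp⟩
  choose! G hG using hex
  have hS : (fun ρ => (G ρ, ρ)) '' (Prod.snd '' S) = S := by
    ext p
    constructor
    · rintro ⟨ρ, hρ, rfl⟩
      exact hG ρ hρ
    · intro hp
      exact ⟨p.2, ⟨p, hp, rfl⟩, hinj (hG _ ⟨p, hp, rfl⟩) hp rfl⟩
  rw [← hS]
  refine isSmoothCurveManifold_graph (isOpen_iff_mem_nhds.2 ?_) (hne.image _) ?_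
  · rintro _ ⟨p, hp, rfl⟩
    obtain ⟨U, hU, hpU, φ, -, hφ⟩ := hloc p hp
    exact mem_of_superset (hU.mem_nhds hpU) fun ρ hρ => ⟨_, hφ ρ hρ, rfl⟩
  · rintro _ ⟨p, hp, rfl⟩
    obtain ⟨U, hU, hpU, φ, hφs, hφ⟩ := hloc p hp
    refine ContDiffAt.contDiffWithinAt ?_
    refine (hφs.contDiffAt (hU.mem_nhds hpU)).congr_of_eventuallyEq ?_
    filter_upwards [hU.mem_nhds hpU] with ρ hρ
    exact congrArg Prod.fst (hinj (hG ρ ⟨_, hφ ρ hρ, rfl⟩) (hφ ρ hρ) rfl)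

end Graph

/-! ### The set of `ρ`-analytic initial data -/

section InvariantCurve

variable {n : ℕ} {A : Matrix (Fin n) (Fin n) ℝ} {b : EuclideanSpace ℝ (Fin n)} {σ : ℝ}
  {f : PhaseSpace n → EuclideanSpace ℝ (Fin n)}

/-- An analytic function which is `O(‖y‖²)` has no terms of degree less than two. -/
lemma hasStrictFDerivAt_zero_of_isBigO {F G : Type*} [NormedAddCommGroup F] [NormedSpace ℝ F]
    [NormedAddCommGroup G] [NormedSpace ℝ G] {f : F → G} (hf : AnalyticAt ℝ f 0)
    (hf2 : f =O[𝓝 0] fun y => ‖y‖ ^ 2) :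
    f 0 = 0 ∧ HasStrictFDerivAt f (0 : F →L[ℝ] G) 0 := by
  have hf2' : f =O[𝓝 0] fun y => ‖y - 0‖ ^ 2 := by simpa using hf2
  refine ⟨hf2'.eq_zero_of_norm_pow two_ne_zero, ?_⟩
  rw [← (hf2'.hasFDerivAt one_lt_two).fderiv]
  exact hf.hasStrictFDerivAt

/-- Under the nonresonance condition the invariance equation has an analytic solution near
`ρ = 0`. -/
theorem exists_analyticOnNhd_solvesInvarianceEq (hσ : 0 < σ) (hf : AnalyticAt ℝ f 0)
    (hf2 : f =O[𝓝 0] fun y => ‖y‖ ^ 2)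
    (hA : ∀ k : ℕ, k ≠ 0 → ∀ v, Matrix.toEuclideanLin A v = (σ * k) • v → v = 0) :
    ∃ ε > (0 : ℝ), ∃ g : ℝ → EuclideanSpace ℝ (Fin n), AnalyticOnNhd ℝ g (Ioo (-ε) ε) ∧ g 0 = 0 ∧
      ∀ ρ ∈ Ioo (-ε) ε, SolvesInvarianceEq
        (LinearMap.toContinuousLinearMap (Matrix.toEuclideanLin A)) b σ f g ρ := by
  obtain ⟨hf0, hf1⟩ := hasStrictFDerivAt_zero_of_isBigO hf hf2
  obtain ⟨R, K, hRK, hR⟩ := exists_bounded_inverses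
    (A := LinearMap.toContinuousLinearMap (Matrix.toEuclideanLin A)) hσ hA
  obtain ⟨g, hg, hg0, hsol⟩ :=
    exists_analyticAt_solvesInvarianceEq (b := b) hf hf0 hf1.hasFDerivAt hRK hR
  obtain ⟨ε, hε, h⟩ := Metric.eventually_nhds_iff_ball.1 (hg.eventually_analyticAt.and hsol)
  rw [Real.ball_eq_Ioo, zero_sub, zero_add] at h
  exact ⟨ε, hε, g, fun ρ hρ => (h ρ hρ).1, hg0, fun ρ hρ => (h ρ hρ).2⟩

lemma IsRhoAnalyticOn.mem_rhoAnalyticSet {v : PhaseSpace n → PhaseSpace n} {y : ℝ → PhaseSpace n}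
    {I : Set ℝ} (h : IsRhoAnalyticOn v y I) {t : ℝ} (ht : t ∈ I) : y t ∈ rhoAnalyticSet v :=
  ⟨_, _, h.translate t, by simpa using ht, by simp⟩

/-- Away from `ρ = 0` the set `W^ρ(0)` is locally a graph over `ρ`: an orbit may be parametrized
by `ρ` instead of `t = log (ρ / ρ₀) / σ`. -/
lemma exists_contDiffOn_of_mem_rhoAnalyticSet (hσ : 0 < σ) (hf : AnalyticOnNhd ℝ f univ)
    {p : PhaseSpace n} (hp : p ∈ rhoAnalyticSet (vectorField A b σ f)) (hp0 : p.2 ≠ 0) :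
    ∃ U : Set ℝ, IsOpen U ∧ p.2 ∈ U ∧ ∃ φ : ℝ → EuclideanSpace ℝ (Fin n), ContDiffOn ℝ ∞ φ U ∧
      ∀ ρ ∈ U, (φ ρ, ρ) ∈ rhoAnalyticSet (vectorField A b σ f) := by
  obtain ⟨y, I, h, h0, rfl⟩ := hp
  set ρ₀ := (y 0).2
  set T : ℝ → ℝ := fun ρ => Real.log (ρ / ρ₀) / σ with hT
  set P : Set ℝ := {ρ | 0 < ρ / ρ₀} with hP
  have hPo : IsOpen P := isOpen_lt continuous_const (continuous_id.div_const ρ₀)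
  have hTs : ContDiffOn ℝ ∞ T P :=
    ((contDiff_id.div_const ρ₀).contDiffOn.log fun ρ hρ => ne_of_gt hρ).div_const σ
  refine ⟨P ∩ T ⁻¹' I, hTs.continuousOn.isOpen_inter_preimage hPo h.isOpen, ⟨?_, ?_⟩,
    fun ρ => (y (T ρ)).1, ?_, ?_⟩
  · simp [hP, div_self hp0]
  · simpa [hT, div_self hp0] using h0
  · have hy := contDiffOn_of_hasDerivAt (contDiff_vectorField hf) h.isOpen
      fun t ht => h.hasDerivAt ht
    exact contDiff_fst.comp_contDiffOn
      (hy.comp (hTs.mono inter_subset_left) fun ρ hρ => hρ.2)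
  · rintro ρ ⟨hρP, hρI⟩
    have h2 : (y (T ρ)).2 = ρ := by
      have hexp : σ * (T ρ - 0) = Real.log (ρ / ρ₀) := by
        simp only [hT]; field_simp; simp
      rw [h.snd_eq h0 hρI, hexp, Real.exp_log hρP]
      exact mul_div_cancel₀ ρ hp0
    have := h.mem_rhoAnalyticSet hρI
    rwa [← Prod.mk.eta (p := y (T ρ)), h2] at this

/-- If two solutions have the same sign of `ρ`, then after a translation of time their
`ρ`-components agree. -/
lemma exists_translate_snd_eq (hσ : 0 < σ) {y₁ y₂ : ℝ → PhaseSpace n} {I₁ I₂ : Set ℝ}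
    (h₁ : IsRhoAnalyticOn (vectorField A b σ f) y₁ I₁)
    (h₂ : IsRhoAnalyticOn (vectorField A b σ f) y₂ I₂) {t₁ t₂ : ℝ} (ht₁ : t₁ ∈ I₁) (ht₂ : t₂ ∈ I₂)
    (hs : SignType.sign (y₁ t₁).2 = SignType.sign (y₂ t₂).2) :
    ∃ τ s : ℝ, s ∈ I₁ ∧ s + τ ∈ I₂ ∧ (y₁ s).2 = (y₂ (s + τ)).2 := by
  obtain ⟨l, hl⟩ : ∃ l : ℝ, (y₁ t₁).2 = (y₂ t₂).2 * Real.exp l := by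
    rcases lt_trichotomy (y₂ t₂).2 0 with h | h | h
    · rw [sign_neg h, sign_eq_neg_one_iff] at hs
      refine ⟨Real.log ((y₁ t₁).2 / (y₂ t₂).2), ?_⟩
      rw [Real.exp_log (div_pos_of_neg_of_neg hs h), mul_div_cancel₀ _ h.ne]
    · rw [h, sign_zero, sign_eq_zero_iff] at hs
      exact ⟨0, by simp [hs, h]⟩
    · rw [sign_pos h, sign_eq_one_iff] at hs
      refine ⟨Real.log ((y₁ t₁).2 / (y₂ t₂).2), ?_⟩
      rw [Real.exp_log (div_pos hs h), mul_div_cancel₀ _ h.ne']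
  set τ := t₂ - t₁ + l / σ with hτ
  obtain ⟨s, hs₁, hs₂⟩ := (h₁.eventually_mem.and
    ((tendsto_atBot_add_const_right atBot τ tendsto_id).eventually h₂.eventually_mem)).exists
  rw [id] at hs₂
  refine ⟨τ, s, hs₁, hs₂, ?_⟩
  rw [h₁.snd_eq ht₁ hs₁, h₂.snd_eq ht₂ hs₂, hl, mul_assoc, ← Real.exp_add]
  congr 2
  rw [hτ]
  field_simp
  ring

end InvariantCurve

theorem theorem1 (n : ℕ) (A : Matrix (Fin n) (Fin n) ℝ) (b : EuclideanSpace ℝ (Fin n))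
    (σ : ℝ) (hσ : 0 < σ)
    (f : PhaseSpace n → EuclideanSpace ℝ (Fin n)) (hf : AnalyticOnNhd ℝ f univ)
    (hf2 : f =O[𝓝 0] fun y => ‖y‖ ^ 2)
    (hA : ∀ z : ℂ, Module.End.HasEigenvalue (Matrix.toLin' (A.map Complex.ofReal)) z →
      ∀ k : ℕ, 0 < k → z.re ≠ σ * k) :
    -- `W^ρ(0)` is a one-dimensional smooth manifold
    IsSmoothCurveManifold (rhoAnalyticSet (vectorField A b σ f)) ∧
    -- near `ρ = 0` it is the graph of a real-analytic `g` with `g 0 = 0`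
    (∃ ε > (0 : ℝ), ∃ g : ℝ → EuclideanSpace ℝ (Fin n),
      AnalyticOnNhd ℝ g (Ioo (-ε) ε) ∧ g 0 = 0 ∧
        {p ∈ rhoAnalyticSet (vectorField A b σ f) | p.2 ∈ Ioo (-ε) ε} =
          (fun ρ : ℝ => (g ρ, ρ)) '' Ioo (-ε) ε) ∧
    -- for each sign of `ρ` there is a `ρ`-analytic solution
    (∀ s : SignType, ∃ (y : ℝ → PhaseSpace n) (I : Set ℝ),
      IsRhoAnalyticOn (vectorField A b σ f) y I ∧ ∀ t ∈ I, SignType.sign (y t).2 = s) ∧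
    -- two `ρ`-analytic solutions with the same sign of `ρ` agree up to a translation of time,
    -- wherever both are defined
    (∀ (y₁ y₂ : ℝ → PhaseSpace n) (I₁ I₂ : Set ℝ),
      IsRhoAnalyticOn (vectorField A b σ f) y₁ I₁ → IsRhoAnalyticOn (vectorField A b σ f) y₂ I₂ →
      ∀ t₁ ∈ I₁, ∀ t₂ ∈ I₂, SignType.sign (y₁ t₁).2 = SignType.sign (y₂ t₂).2 →
        ∃ τ : ℝ, ∀ t ∈ I₁, t + τ ∈ I₂ → y₁ t = y₂ (t + τ)) := by
  have hA' := eq_zero_of_toEuclideanLin_eq_smul hA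
  have hf' := (hasStrictFDerivAt_zero_of_isBigO (hf 0 (mem_univ _)) hf2).2
  obtain ⟨ε, hε, g, hg, hg0, hsol⟩ :=
    exists_analyticOnNhd_solvesInvarianceEq (b := b) hσ (hf 0 (mem_univ _)) hf2 hA'
  have hinj : InjOn Prod.snd (rhoAnalyticSet (vectorField A b σ f)) := by
    rintro _ ⟨y₁, I₁, h₁, h₁0, rfl⟩ _ ⟨y₂, I₂, h₂, h₂0, rfl⟩ h
    exact h₁.eq_of_snd_eq hσ hf hf' hA' h₂ h₁0 h₂0 h ⟨h₁0, h₂0⟩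
  have hgraph : ∀ ρ ∈ Ioo (-ε) ε, (g ρ, ρ) ∈ rhoAnalyticSet (vectorField A b σ f) := fun ρ hρ =>
    ⟨_, _, isRhoAnalyticOn_graph hσ hε hg hg0 hsol ρ, by simpa using hρ, by simp⟩
  have h0 : (0 : ℝ) ∈ Ioo (-ε) ε := ⟨by linarith, hε⟩
  refine ⟨?_, ⟨ε, hε, g, hg, hg0, ?_⟩, fun s => ?_, ?_⟩
  · refine isSmoothCurveManifold_of_locally_graph ⟨_, hgraph 0 h0⟩ hinj fun p hp => ?_
    rcases eq_or_ne p.2 0 with hp0 | hp0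
    · exact ⟨_, isOpen_Ioo, hp0 ▸ h0, g, hg.contDiffOn (uniqueDiffOn_Ioo _ _), hgraph⟩
    · exact exists_contDiffOn_of_mem_rhoAnalyticSet hσ hf hp hp0
  · ext p
    constructor
    · rintro ⟨hp, hpε⟩
      exact ⟨p.2, hpε, hinj (hgraph _ hpε) hp rfl⟩
    · rintro ⟨ρ, hρ, rfl⟩
      exact ⟨hgraph ρ hρ, hρ⟩
  · refine ⟨_, _, isRhoAnalyticOn_graph hσ hε hg hg0 hsol (s : ℝ), fun t _ => ?_⟩
    rw [sign_mul, sign_pos (Real.exp_pos _), mul_one]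
    cases s <;> simp
  · intro y₁ y₂ I₁ I₂ h₁ h₂ t₁ ht₁ t₂ ht₂ hs
    obtain ⟨τ, s, hs₁, hs₂, hρ⟩ := exists_translate_snd_eq hσ h₁ h₂ ht₁ ht₂ hs
    exact ⟨τ, fun t ht ht' =>
      h₁.eq_of_snd_eq hσ hf hf' hA' (h₂.translate τ) hs₁ hs₂ hρ ⟨ht, ht'⟩⟩
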